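/- Let $\mathrm{HF}_n$ be the collection of hereditarily finite sets of rank at most $n$ (with $r(\emptyset)=0$), and for hereditarily finite $A$ put $F(0,A)=\emptyset$, $F(n+1,A)=\{F(n,x)\mid x\in A\}$. A *set of AS* (AS-set) $A$ is given by an arbitrary sequence $(F(n,A))_{n\ge 0}$ with $F(n,A)\in \mathrm{HF}_n$ and $F(n,F(n+1,A))=F(n,A)$ for all $n$; every such sequence determines exactly one AS-set. For AS-sets, $x\in A$ means that $F(n,x)\in F(n+1,A)$ for every $n$; $B\subseteq A$ means that every element of $B$ is an element of $A$; $\{a,b\}$ is the AS-set whose only elements are $a,b$, and $(a,b)=\{\{a\},\{a,b\}\}$. A *function* from $A$ to $B$ is an AS-set $f$ all of whose elements are pairs $(a,b)$ with $a\in A$, $b\in B$, and which is total on $A$ and functional; injections and bijections are defined as usual and are thus themselves AS-sets. Write $A\le_c B$ if there is an injection from $A$ into $B$, $A=_cB$ if $A\le_c B$ and $B\le_c A$, and $A<_cB$ if $A\le_c B$ but not $A=_cB$. In the topology of approximations the neighbourhoods of $x$ are the collections $\{y\mid F(n,y)=F(n,x)\}$, $n\ge 0$; $x$ is an accumulation point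 in $A$ if each of them contains some $y\in A$, $y\neq x$. An AS-set is *perfect* if it is nonempty, closed (contains its accumulation points), and each of its elements is an accumulation point in it. **Theorem 7.15.** (No choice principle for AS-sets is assumed.) The cardinalities of two arbitrary AS-sets $A$ and $B$ are always comparable, that is, $A\le_cB$ or $B\le_cA$, and precisely one of $A<_cB$, $A=_cB$, $B<_cA$ holds. Moreover (Lemma 6.2), if $P$ is a perfect AS-set, then every AS-set is in bijection with some subset of $P$; hence an AS-set $B$ that contains a perfect subset has the greatest cardinality: $A\le_cB$ for every AS-set $A$. -/

import Mathlib

namespace AS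

/-- `HF n` is the type of hereditarily finite sets of rank at most `n`: the only one of rank `0` is
the empty set, and those of rank at most `n + 1` are the finite sets of hereditarily finite sets of
rank at most `n` (equality is extensional). These are the nodes on level `n` of the universal
tree. -/
def HF : ℕ → Type
  | 0 => Unit
  | n + 1 => Finset (HF n)

instance HF.instDecidableEq : (n : ℕ) → DecidableEq (HF n)
  | 0 => inferInstanceAs (DecidableEq Unit)
  | n + 1 => @Finset.decidableEq (HF n) (HF.instDecidableEq n)

/-- The finite set of elements of a hereditarily finite set of rank at most `n + 1`. -/
def HF.elems {n : ℕ} (A : HF (n + 1)) : Finset (HF n) := A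

/-- The approximation `F(n, A)` of a hereditarily finite set `A` of rank at most `n + 1`:
`F(0, A) = ∅` and `F(n + 1, A) = {F(n, x) | x ∈ A}`. -/
def F : (n : ℕ) → HF (n + 1) → HF n
  | 0, _ => ()
  | n + 1, A => (HF.elems A).image (F n)

/-- A set of the theory AS is (represented by) an infinite path in the universal tree, that is, by
an arbitrary sequence `F(0, A), F(1, A), F(2, A), …` of hereditarily finite sets in which the
`n`-th term is the approximation `F(n, ·)` of the next one. -/
@[ext]
structure ASet where
  approx : (n : ℕ) → HF n
  coherent : ∀ n, F n (approx (n + 1)) = approx n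

namespace ASet

/-- `x ∈ A` if and only if `F(n, x) ∈ F(n + 1, A)` for every `n`. -/
instance : Membership ASet ASet :=
  ⟨fun A x => ∀ n, x.approx n ∈ HF.elems (A.approx (n + 1))⟩

instance : HasSubset ASet := ⟨fun B A => ∀ x : ASet, x ∈ B → x ∈ A⟩

theorem mem_iff {x A : ASet} : x ∈ A ↔ ∀ n, x.approx n ∈ HF.elems (A.approx (n + 1)) := Iff.rfl

/-- The approximations of the pair `{a, b}`: `∅` and then `{F(n, a), F(n, b)}`. -/
def pairApprox (a b : ASet) : (n : ℕ) → HF n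
  | 0 => ()
  | n + 1 => ({a.approx n, b.approx n} : Finset (HF n))

/-- The pair `{a, b}`. -/
def pair (a b : ASet) : ASet where
  approx := pairApprox a b
  coherent
    | 0 => rfl
    | n + 1 => by
      change Finset.image (F n) {a.approx (n + 1), b.approx (n + 1)} =
        ({a.approx n, b.approx n} : Finset (HF n))
      rw [Finset.image_insert, Finset.image_singleton, a.coherent, b.coherent]

theorem approx_eq_of_le {x y : ASet} {n m : ℕ} (h : n ≤ m) (e : x.approx m = y.approx m) :
    x.approx n = y.approx n := by
  induction m, h using Nat.le_induction with
  | base => exact e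
  | succ k _ ih => exact ih (by rw [← x.coherent, ← y.coherent, e])

/-- The elements of `{a, b}` are precisely `a` and `b`. -/
theorem mem_pair {x a b : ASet} : x ∈ pair a b ↔ x = a ∨ x = b := by
  have key : x ∈ pair a b ↔ ∀ n, x.approx n = a.approx n ∨ x.approx n = b.approx n := by
    refine forall_congr' fun n => ?_
    change x.approx n ∈ ({a.approx n, b.approx n} : Finset (HF n)) ↔ _
    simp
  rw [key]
  constructor
  · intro h
    by_contra hne
    obtain ⟨ha, hb⟩ := not_or.mp hne
    obtain ⟨i, hi⟩ : ∃ i, x.approx i ≠ a.approx i := by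
      by_contra hc
      push Not at hc
      exact ha (ASet.ext (funext hc))
    obtain ⟨j, hj⟩ : ∃ j, x.approx j ≠ b.approx j := by
      by_contra hc
      push Not at hc
      exact hb (ASet.ext (funext hc))
    rcases h (max i j) with e | e
    · exact hi (approx_eq_of_le (le_max_left i j) e)
    · exact hj (approx_eq_of_le (le_max_right i j) e)
  · rintro (rfl | rfl) n
    · exact Or.inl rfl
    · exact Or.inr rfl

/-- The ordered pair `(a, b) = {{a}, {a, b}}`. -/
def opair (a b : ASet) : ASet := pair (pair a a) (pair a b)

/-- `R` is a relation between the elements of `A` and `B`: a subset of `A × B`. -/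
def IsRelation (R A B : ASet) : Prop := ∀ p ∈ R, ∃ a ∈ A, ∃ b ∈ B, p = opair a b

/-- The set `f` is a function from `A` to `B`: a total and functional relation. -/
def IsFunction (f A B : ASet) : Prop :=
  IsRelation f A B ∧ (∀ a ∈ A, ∃ b ∈ B, opair a b ∈ f) ∧
    ∀ a b b' : ASet, opair a b ∈ f → opair a b' ∈ f → b = b'

/-- The set `f` is an injection from `A` into `B`. -/
def IsInjection (f A B : ASet) : Prop :=
  IsFunction f A B ∧ ∀ a a' b : ASet, opair a b ∈ f → opair a' b ∈ f → a = a'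

/-- The set `f` is a bijection from `A` to `B`. -/
def IsBijection (f A B : ASet) : Prop :=
  IsInjection f A B ∧ ∀ b ∈ B, ∃ a ∈ A, opair a b ∈ f

/-- `A ≤_c B`: there is an injection from `A` into `B`, the injection being itself a set of AS. -/
def CardLE (A B : ASet) : Prop := ∃ f : ASet, IsInjection f A B

/-- `A =_c B`. -/
def CardEq (A B : ASet) : Prop := CardLE A B ∧ CardLE B A

/-- `A <_c B`. -/
def CardLT (A B : ASet) : Prop := CardLE A B ∧ ¬ CardEq A B

/-- `x` is an accumulation point in `A` for the topology of approximations, in which the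
neighbourhoods of `x` are the sets `{y | F(n, y) = F(n, x)}`. -/
def IsAccPt (x A : ASet) : Prop := ∀ n, ∃ y ∈ A, y.approx n = x.approx n ∧ y ≠ x

/-- A perfect set: nonempty, closed, and each of its elements is an accumulation point in it. -/
def IsPerfect (P : ASet) : Prop :=
  (∃ x, x ∈ P) ∧ (∀ x, IsAccPt x P → x ∈ P) ∧ ∀ x ∈ P, IsAccPt x P

end ASet

end AS

/-! The universe of AS-sets with the topology of approximations is a closed subspace of a product of
finite discrete spaces, hence compact, Polish and totally disconnected. The element collections of
AS-sets are exactly its closed subsets (`isClosed_mem`, `mem_ofSet`). A continuous injection on a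
closed set has a compact graph, which is therefore itself an AS-set. So it suffices to compare
closed sets under continuous injections (`EmbedsInto`).

If one of them has a nonempty perfect kernel, that kernel contains a Cantor set, into which
everything embeds (`Perfect.embedsInto`). Otherwise both are scattered, and a nonempty compact
scattered set has a last nonempty Cantor–Bendixson derivative, which is finite. As in the
Mazurkiewicz–Sierpiński classification, the pairs (stage of that derivative, number of its points)
are compared lexicographically, and the set with the smaller pair embeds. The core is a transfinite
induction on rank: a point is surrounded by clopen shells whose points have lower rank, and the
shells are embedded one by one closer and closer to the target point. -/

open Set Filter Topology
open scoped CantorBendixson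

/-! ### Gluing continuous injections -/

section Embedding

universe u v

variable {X : Type u} {Y : Type v} [TopologicalSpace X] [TopologicalSpace Y]

/-- Some function is continuous and injective on `s` and maps `s` into `t`. -/
def EmbedsInto (s : Set X) (t : Set Y) : Prop :=
  ∃ g : X → Y, ContinuousOn g s ∧ MapsTo g s t ∧ InjOn g s

theorem EmbedsInto.mono {s s' : Set X} {t t' : Set Y} (h : EmbedsInto s t) (hs : s' ⊆ s)
    (ht : t ⊆ t') : EmbedsInto s' t' := by
  obtain ⟨g, hc, hm, hi⟩ := h
  exact ⟨g, hc.mono hs, fun x hx => ht (hm (hs hx)), hi.mono hs⟩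

theorem embedsInto_empty [Nonempty Y] (t : Set Y) : EmbedsInto (∅ : Set X) t :=
  ⟨fun _ => Classical.arbitrary Y, continuousOn_empty _, mapsTo_empty _ _, injOn_empty _⟩

/-- A clopen set has empty frontier, so the piecewise map is continuous; disjointness of the targets
keeps it injective. -/
theorem EmbedsInto.of_isClopen_split {s w : Set X} {t t₁ t₂ : Set Y} (hw : IsClopen w)
    (h₁ : EmbedsInto (s ∩ w) t₁) (h₂ : EmbedsInto (s \ w) t₂) (hd : Disjoint t₁ t₂)
    (ht₁ : t₁ ⊆ t) (ht₂ : t₂ ⊆ t) : EmbedsInto s t := by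
  classical
  obtain ⟨f, fc, fm, fi⟩ := h₁
  obtain ⟨g, gc, gm, gi⟩ := h₂
  have hne : ∀ x ∈ s, ∀ y ∈ s, x ∈ w → y ∉ w → f x ≠ g y := fun x hx y hy hxw hyw e =>
    disjoint_left.mp hd (fm ⟨hx, hxw⟩) (e ▸ gm ⟨hy, hyw⟩)
  refine ⟨w.piecewise f g, ContinuousOn.piecewise ?_ ?_ ?_, fun x hx => ?_, fun x hx y hy e => ?_⟩
  · simp [hw.frontier_eq]
  · rwa [hw.isClosed.closure_eq]
  · rwa [hw.compl.isClosed.closure_eq, ← sdiff_eq]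
  · by_cases hxw : x ∈ w
    · simpa [hxw] using ht₁ (fm ⟨hx, hxw⟩)
    · simpa [hxw] using ht₂ (gm ⟨hx, hxw⟩)
  · by_cases hxw : x ∈ w <;> by_cases hyw : y ∈ w <;> simp only [piecewise, hxw, hyw, if_true,
      if_false] at e
    · exact fi ⟨hx, hxw⟩ ⟨hy, hyw⟩ e
    · exact absurd e (hne x hx y hy hxw hyw)
    · exact absurd e.symm (hne y hy x hx hyw hxw)
    · exact gi ⟨hx, hxw⟩ ⟨hy, hyw⟩ e

theorem Antitone.eq_of_mem_sdiff_succ {α : Type*} {U : ℕ → Set α} (hU : Antitone U) {z : α}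
    {m n : ℕ} (hm : z ∈ U m \ U (m + 1)) (hn : z ∈ U n \ U (n + 1)) : m = n := by
  rcases lt_trichotomy m n with hlt | heq | hgt
  · exact absurd (hU (Nat.succ_le_of_lt hlt) hn.1) hm.2
  · exact heq
  · exact absurd (hU (Nat.succ_le_of_lt hgt) hm.1) hn.2

/-- Embeddings of the shells around `x` into disjoint shells around `y` fit together. -/
theorem EmbedsInto.of_shells {s : Set X} {x : X} {y : Y} {U : ℕ → Set X} {V : ℕ → Set Y}
    {t : Set Y} (hU : Antitone U) (hU0 : U 0 = univ) (hUc : ∀ n, IsClopen (U n))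
    (hUb : (𝓝 x).HasBasis (fun _ => True) U) (hUx : ⋂ n, U n = {x})
    (hV : Antitone V) (hVb : (𝓝 y).HasBasis (fun _ => True) V) (hyt : y ∈ t)
    (h : ∀ n, EmbedsInto (s ∩ (U n \ U (n + 1))) (t ∩ (V n \ V (n + 1)))) :
    EmbedsInto s t := by
  classical
  choose g gc gm gi using h
  have shell : ∀ z, z ≠ x → ∃ n, z ∈ U n \ U (n + 1) := by
    intro z hz
    have hex : ∃ n, z ∉ U n := by
      by_contra hc
      push Not at hc
      exact hz (hUx.subset (mem_iInter.mpr hc))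
    obtain ⟨m, hm⟩ : ∃ m, Nat.find hex = m + 1 := by
      refine Nat.exists_eq_succ_of_ne_zero fun h0 => ?_
      have := Nat.find_spec hex
      rw [h0, hU0] at this
      exact this (mem_univ _)
    refine ⟨m, not_not.mp (Nat.find_min hex (by omega)), hm ▸ Nat.find_spec hex⟩
  have hxU : ∀ n, x ∈ U n := fun n => mem_of_mem_nhds (hUb.mem_of_mem trivial)
  have hyV : ∀ n, y ∈ V n := fun n => mem_of_mem_nhds (hVb.mem_of_mem trivial)
  -- Off `x` the shells partition the space, since the `U n` start at `univ` and shrink to `x`; on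
  -- each shell `G` is the given embedding.
  let G : X → Y := fun z => if hz : z = x then y else g (shell z hz).choose z
  have Gx : G x = y := dif_pos rfl
  have Gs : ∀ {z n}, z ∈ U n \ U (n + 1) → G z = g n z := by
    intro z n hz
    have hzx : z ≠ x := fun e => hz.2 (e ▸ hxU _)
    have : (shell z hzx).choose = n :=
      hU.eq_of_mem_sdiff_succ (shell z hzx).choose_spec hz
    simp only [G, dif_neg hzx, this]
  have Gm : ∀ {z n}, z ∈ s → z ∈ U n \ U (n + 1) → G z ∈ t ∩ (V n \ V (n + 1)) := by
    intro z n hzs hz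
    rw [Gs hz]
    exact gm n ⟨hzs, hz⟩
  refine ⟨G, fun z hzs => ?_, fun z hzs => ?_, fun z hzs w hws e => ?_⟩
  · by_cases hzx : z = x
    · subst hzx
      -- At the centre: a point of `U k` other than the centre lies in a shell of index at least
      -- `k`, so its image lies in `V k`.
      rw [ContinuousWithinAt, Gx, hVb.tendsto_right_iff]
      intro k _
      filter_upwards [self_mem_nhdsWithin, mem_nhdsWithin_of_mem_nhds (hUb.mem_of_mem (i := k)
        trivial)] with w hws hwk
      by_cases hwx : w = z
      · rw [hwx, Gx]
        exact hyV k
      · obtain ⟨n, hn⟩ := shell w hwx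
        have hkn : k ≤ n := by
          by_contra hlt
          exact hn.2 (hU (by omega) hwk)
        exact hV hkn (Gm hws hn).2.1
    · obtain ⟨n, hn⟩ := shell z hzx
      have hnb : U n \ U (n + 1) ∈ 𝓝 z := ((hUc n).diff (hUc (n + 1))).isOpen.mem_nhds hn
      have hcw : ContinuousWithinAt (g n) s z :=
        (continuousWithinAt_inter hnb).mp (gc n z ⟨hzs, hn⟩)
      refine hcw.congr_of_eventuallyEq ?_ (Gs hn)
      filter_upwards [mem_nhdsWithin_of_mem_nhds hnb] with w hw using Gs hw
  · by_cases hzx : z = x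
    · rw [hzx, Gx]
      exact hyt
    · obtain ⟨n, hn⟩ := shell z hzx
      exact (Gm hzs hn).1
  · by_cases hzx : z = x <;> by_cases hwx : w = x
    · rw [hzx, hwx]
    -- The point `y` lies in every `V n`, hence in no target shell.
    · obtain ⟨n, hn⟩ := shell w hwx
      rw [hzx, Gx] at e
      exact absurd (e ▸ hyV (n + 1)) (Gm hws hn).2.2
    · obtain ⟨n, hn⟩ := shell z hzx
      rw [hwx, Gx] at e
      exact absurd (e.symm ▸ hyV (n + 1)) (Gm hzs hn).2.2
    · obtain ⟨m, hm⟩ := shell z hzx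
      obtain ⟨n, hn⟩ := shell w hwx
      have h₁ := (Gm hzs hm).2
      have h₂ := (Gm hws hn).2
      rw [← e] at h₂
      obtain rfl := hV.eq_of_mem_sdiff_succ h₁ h₂
      rw [Gs hm, Gs hn] at e
      exact gi m ⟨hzs, hm⟩ ⟨hws, hn⟩ e

end Embedding

/-! ### Cantor–Bendixson ranks and scattered sets -/

section Scattered

universe u

variable {X Y : Type u} [TopologicalSpace X] [TopologicalSpace Y]

/-- Limit stages are intersections, so a point can be lost only in passing from some `b` to `b + 1`;
this `b` is its rank. -/
theorem exists_mem_iteratedDerivedSet_notMem_derivedSet {A : Set X} {z : X} {a : Ordinal}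
    (hz : z ∈ A) (hza : z ∉ Aᵈ[a]) : ∃ b < a, z ∈ Aᵈ[b] ∧ z ∉ derivedSet Aᵈ[b] := by
  induction a using Ordinal.limitRecOn with
  | zero => simp [hz] at hza
  | add_one a ih =>
    by_cases h : z ∈ Aᵈ[a]
    · refine ⟨a, Order.lt_add_one_iff.mpr le_rfl, h, fun hd => hza ?_⟩
      rw [CantorBendixson.iteratedDerivedSet_succ]
      exact ⟨hd, h⟩
    · obtain ⟨b, hb, h'⟩ := ih h
      exact ⟨b, hb.trans (Order.lt_add_one_iff.mpr le_rfl), h'⟩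
  | limit a ha ih =>
    rw [CantorBendixson.iteratedDerivedSet_limit ha] at hza
    simp only [mem_iInter, not_forall] at hza
    obtain ⟨⟨b, hb⟩, hzb⟩ := hza
    obtain ⟨c, hc, h'⟩ := ih b hb hzb
    exact ⟨c, hc.trans hb, h'⟩

theorem mem_derivedSet_iteratedDerivedSet_of_lt {B : Set Y} {y : Y} {a b : Ordinal}
    (hy : y ∈ Bᵈ[a]) (hb : b < a) : y ∈ derivedSet Bᵈ[b] := by
  have := CantorBendixson.iteratedDerivedSet_antitone B (Order.add_one_le_of_lt hb) hy
  rw [CantorBendixson.iteratedDerivedSet_succ] at this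
  exact this.1

theorem iteratedDerivedSet_subset (A : Set X) (a : Ordinal) : Aᵈ[a] ⊆ A := by
  simpa using CantorBendixson.iteratedDerivedSet_antitone A (zero_le (a := a))

variable [CompactSpace X] [T2Space X] [TotallyDisconnectedSpace X]

theorem exists_isClopen_inter_subset_singleton {S : Set X} {z : X} (h : z ∉ derivedSet S) :
    ∃ w, IsClopen w ∧ z ∈ w ∧ S ∩ w ⊆ {z} := by
  rw [mem_derivedSet, accPt_iff_nhds] at h
  push Not at h
  obtain ⟨u, hu, h⟩ := h
  obtain ⟨w, hw, hzw, hwu⟩ := compact_exists_isClopen_in_isOpen isOpen_interior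
    (mem_interior_iff_mem_nhds.mpr hu)
  exact ⟨w, hw, hzw, fun v hv => h v ⟨interior_subset (hwu hv.2), hv.1⟩⟩

theorem exists_isClopen_mem_notMem {y y' : X} (h : y' ≠ y) :
    ∃ w, IsClopen w ∧ y ∈ w ∧ y' ∉ w := by
  obtain ⟨w, hw, hyw, hsub⟩ := compact_exists_isClopen_in_isOpen
    (isOpen_compl_singleton (x := y')) (x := y) (by simpa using h.symm)
  exact ⟨w, hw, hyw, fun h => hsub h rfl⟩

theorem exists_antitone_isClopen_basis [FirstCountableTopology X] (x : X) :
    ∃ U : ℕ → Set X, Antitone U ∧ U 0 = univ ∧ (∀ n, IsClopen (U n)) ∧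
      (𝓝 x).HasBasis (fun _ => True) U ∧ ⋂ n, U n = {x} := by
  obtain ⟨N, hN⟩ := (𝓝 x).exists_antitone_basis
  have hx : ∀ n, x ∈ interior (N n) := fun n => mem_interior_iff_mem_nhds.mpr (hN.mem n)
  choose C hC hxC hCN using fun n => compact_exists_isClopen_in_isOpen isOpen_interior (hx n)
  let U : ℕ → Set X := fun n => ⋂ i ∈ Finset.range n, C i
  have hUc : ∀ n, IsClopen (U n) := fun n => isClopen_biInter_finset fun i _ => hC i
  have hUx : ∀ n, x ∈ U n := fun n => mem_iInter₂.mpr fun i _ => hxC i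
  have hUN : ∀ n, U (n + 1) ⊆ N n := fun n =>
    (biInter_subset_of_mem (by simp)).trans ((hCN n).trans interior_subset)
  have hb : (𝓝 x).HasBasis (fun _ => True) U := by
    refine ⟨fun t => ⟨fun ht => ?_, ?_⟩⟩
    · obtain ⟨n, -, hn⟩ := hN.1.mem_iff.mp ht
      exact ⟨n + 1, trivial, (hUN n).trans hn⟩
    · rintro ⟨n, -, hn⟩
      exact mem_of_superset ((hUc n).isOpen.mem_nhds (hUx n)) hn
  refine ⟨U, fun m n h => ?_, by simp [U], hUc, hb, ?_⟩
  · exact biInter_subset_biInter_left fun i hi => Finset.range_mono h hi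
  · refine subset_antisymm (fun z hz => ?_) (singleton_subset_iff.mpr (mem_iInter.mpr hUx))
    by_contra hzx
    obtain ⟨w, hw, hxw, hzw⟩ := exists_isClopen_mem_notMem (y := x) (y' := z) hzx
    obtain ⟨n, -, hn⟩ := hb.mem_iff.mp (hw.isOpen.mem_nhds hxw)
    exact hzw (hn (mem_iInter.mp hz n))

theorem exists_isClopen_inter_subset_singleton_of_finite {S : Set X} (hS : S.Finite) (z : X) :
    ∃ w, IsClopen w ∧ z ∈ w ∧ S ∩ w ⊆ {z} := by
  obtain ⟨w, hw, hzw, h⟩ := compact_exists_isClopen_in_isOpen (x := z)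
    (U := (S \ {z})ᶜ) (hS.subset sdiff_subset).isClosed.isOpen_compl
    (by simp)
  exact ⟨w, hw, hzw, fun v hv => by_contra fun hvz => h hv.2 ⟨hv.1, hvz⟩⟩

/-- Let `c` be the first stage with empty derivative. Each point has a neighbourhood meeting some
earlier derivative in at most that point. By compactness finitely many neighbourhoods suffice, and
the largest stage `b < c` involved has a finite derivative, nonempty by minimality of `c`. -/
theorem exists_iteratedDerivedSet_finite_nonempty {A : Set X} (hA : IsClosed A)
    (hne : A.Nonempty) (hk : CantorBendixson.perfectKernel A = ∅) :
    ∃ a : Ordinal, (Aᵈ[a]).Nonempty ∧ (Aᵈ[a]).Finite ∧ Aᵈ[a + 1] = ∅ := by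
  have hex : ∃ a : Ordinal, Aᵈ[a] = ∅ := by
    obtain ⟨a, ha⟩ := CantorBendixson.iteratedDerivedSet_mem_fixedPoints A
    exact ⟨a, by
      rw [← CantorBendixson.perfectKernel_eq_iteratedDerivedSet_of_mem_fixedPoints ha, hk]⟩
  obtain ⟨c, hc, hmin⟩ := WellFounded.has_min (wellFounded_lt (α := Ordinal))
    {a : Ordinal | Aᵈ[a] = ∅} hex
  have hlow : ∀ z ∈ A, ∃ b < c, ∃ u ∈ 𝓝[A] z, Aᵈ[b] ∩ u ⊆ {z} := fun z hz => by
    obtain ⟨b, hb, -, hzb⟩ := exists_mem_iteratedDerivedSet_notMem_derivedSet (a := c) hz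
      (hc ▸ notMem_empty z)
    obtain ⟨u, hu, hzu, hus⟩ := exists_isClopen_inter_subset_singleton hzb
    exact ⟨b, hb, u, mem_nhdsWithin_of_mem_nhds (hu.isOpen.mem_nhds hzu), hus⟩
  have hc0 : 0 < c := pos_of_ne_zero fun h => by
    subst h
    simp only [mem_ofPred_eq, CantorBendixson.iteratedDerivedSet_zero] at hc
    exact hne.ne_empty hc
  obtain ⟨b, hb, hfin⟩ : ∃ b < c, (Aᵈ[b] ∩ A).Finite := by
    refine hA.isCompact.induction_on (p := fun s => ∃ b < c, (Aᵈ[b] ∩ s).Finite)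
      ⟨0, hc0, by simp⟩ ?_ ?_ ?_
    · rintro s t hst ⟨b, hb, h⟩
      exact ⟨b, hb, h.subset (inter_subset_inter_right _ hst)⟩
    · rintro s t ⟨b, hb, h⟩ ⟨b', hb', h'⟩
      refine ⟨max b b', max_lt hb hb', ?_⟩
      rw [inter_union_distrib_left]
      exact (h.subset (inter_subset_inter_left _
        (CantorBendixson.iteratedDerivedSet_antitone A (le_max_left _ _)))).union
        (h'.subset (inter_subset_inter_left _
          (CantorBendixson.iteratedDerivedSet_antitone A (le_max_right _ _))))
    · intro z hz
      obtain ⟨b, hb, u, hu, hus⟩ := hlow z hz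
      exact ⟨u, hu, b, hb, (finite_singleton z).subset hus⟩
  have hfin' := hfin.subset (subset_inter subset_rfl (iteratedDerivedSet_subset A b))
  refine ⟨b, nonempty_iff_ne_empty.mpr fun h => hmin b h hb, hfin', ?_⟩
  rw [CantorBendixson.iteratedDerivedSet_succ]
  refine eq_empty_of_forall_notMem fun z hz => ?_
  obtain ⟨w, hw, hzw, hws⟩ := exists_isClopen_inter_subset_singleton_of_finite hfin' z
  obtain ⟨y, hy, hyz⟩ := accPt_iff_nhds.mp (mem_derivedSet.mp hz.1) w (hw.isOpen.mem_nhds hzw)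
  exact hyz (hws hy.symm)

variable [CompactSpace Y] [T2Space Y] [TotallyDisconnectedSpace Y]

/-- A part of `A` without points of Cantor–Bendixson rank `a` embeds into `B` near any point of
rank `a`, while avoiding a neighbourhood of this point, if this holds for small neighbourhoods
of points of lower rank. -/
theorem embedsInto_diff_of_local {A : Set X} {B : Set Y} (hA : IsClosed A) {a : Ordinal}
    (ih : ∀ b < a, ∀ x : X, ∀ w, IsClopen w → x ∈ w → Aᵈ[b] ∩ w ⊆ {x} → ∀ y ∈ Bᵈ[b],
      ∀ v, IsClopen v → y ∈ v → EmbedsInto (A ∩ w) (B ∩ v))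
    {w : Set X} (hw : IsClopen w) (haw : Aᵈ[a] ∩ w = ∅) {y : Y} (hy : y ∈ Bᵈ[a])
    {v : Set Y} (hv : IsClopen v) (hyv : y ∈ v) :
    ∃ v' ⊆ v, IsClopen v' ∧ y ∈ v' ∧ EmbedsInto (A ∩ w) (B ∩ (v \ v')) := by
  have : Nonempty Y := ⟨y⟩
  -- Compactness induction. Quantifying over `v` inside the predicate lets each further piece be
  -- placed in the neighbourhood of `y` left free by the previous ones; the clopen `c` makes gluing
  -- possible.
  have key : ∃ c, IsClopen c ∧ A ∩ w ⊆ c ∧ ∀ v, IsClopen v → y ∈ v →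
      ∃ v' ⊆ v, IsClopen v' ∧ y ∈ v' ∧ EmbedsInto (A ∩ c) (B ∩ (v \ v')) := by
    refine (hA.inter hw.isClosed).isCompact.induction_on (p := fun s => ∃ c, IsClopen c ∧ s ⊆ c ∧
      ∀ v, IsClopen v → y ∈ v →
        ∃ v' ⊆ v, IsClopen v' ∧ y ∈ v' ∧ EmbedsInto (A ∩ c) (B ∩ (v \ v'))) ?_ ?_ ?_ ?_
    · refine ⟨∅, isClopen_empty, subset_rfl, fun v hv hyv => ⟨v, subset_rfl, hv, hyv, ?_⟩⟩
      rw [inter_empty]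
      exact embedsInto_empty _
    · rintro s t hst ⟨c, hc, htc, h⟩
      exact ⟨c, hc, hst.trans htc, h⟩
    · rintro s t ⟨c, hc, hsc, h⟩ ⟨d, hd, htd, h'⟩
      refine ⟨c ∪ d, hc.union hd, union_subset_union hsc htd, fun v hv hyv => ?_⟩
      obtain ⟨v₁, hv₁v, hv₁, hyv₁, e₁⟩ := h v hv hyv
      obtain ⟨v₂, hv₂v, hv₂, hyv₂, e₂⟩ := h' v₁ hv₁ hyv₁
      refine ⟨v₂, hv₂v.trans hv₁v, hv₂, hyv₂, EmbedsInto.of_isClopen_split hc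
        (e₁.mono (by grind) subset_rfl) (e₂.mono (by grind) subset_rfl) ?_ ?_ ?_⟩
      · exact disjoint_left.mpr fun z hz hz' => hz.2.2 hz'.2.1
      · exact fun z hz => ⟨hz.1, hz.2.1, fun h => hz.2.2 (hv₂v h)⟩
      · exact fun z hz => ⟨hz.1, hv₁v hz.2.1, hz.2.2⟩
    · rintro z ⟨hzA, hzw⟩
      have hza : z ∉ Aᵈ[a] := fun h => (haw.subset ⟨h, hzw⟩ : z ∈ (∅ : Set X))
      obtain ⟨b, hb, -, hzb⟩ := exists_mem_iteratedDerivedSet_notMem_derivedSet hzA hza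
      obtain ⟨c, hc, hzc, hcs⟩ := exists_isClopen_inter_subset_singleton hzb
      refine ⟨c, mem_nhdsWithin_of_mem_nhds (hc.isOpen.mem_nhds hzc), c, hc, subset_rfl,
        fun v hv hyv => ?_⟩
      -- Since `b < a`, points `y' ≠ y` of `Bᵈ[b]` accumulate at `y`; the piece goes near such a
      -- `y'`, separated from `y` by `u`.
      have hyb := mem_derivedSet_iteratedDerivedSet_of_lt hy hb
      rw [mem_derivedSet, accPt_iff_nhds] at hyb
      obtain ⟨y', ⟨hy'v, hy'b⟩, hne⟩ := hyb v (hv.isOpen.mem_nhds hyv)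
      obtain ⟨u, hu, hyu, hy'u⟩ := exists_isClopen_mem_notMem hne
      refine ⟨v ∩ u, inter_subset_left, hv.inter hu, ⟨hyv, hyu⟩, ?_⟩
      exact ih b hb z c hc hzc hcs y' hy'b _ (hv.diff (hv.inter hu)) ⟨hy'v, fun h => hy'u h.2⟩
  obtain ⟨c, -, hwc, h⟩ := key
  obtain ⟨v', hv'v, hv', hyv', e⟩ := h v hv hyv
  exact ⟨v', hv'v, hv', hyv', e.mono (fun z hz => ⟨hz.1, hwc hz⟩) subset_rfl⟩

variable [FirstCountableTopology X] [FirstCountableTopology Y]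

/-- If `x` is the only point of `A ∩ w` whose Cantor–Bendixson rank is at least `a`, then `A ∩ w`
embeds into every neighbourhood of every point of `B` of rank at least `a`. -/
theorem embedsInto_of_iteratedDerivedSet_inter_subset_singleton {A : Set X} {B : Set Y}
    (hA : IsClosed A) (a : Ordinal) (x : X) (w : Set X) (hw : IsClopen w) (hxw : x ∈ w)
    (h : Aᵈ[a] ∩ w ⊆ {x}) (y : Y) (hy : y ∈ Bᵈ[a]) (v : Set Y) (hv : IsClopen v)
    (hyv : y ∈ v) : EmbedsInto (A ∩ w) (B ∩ v) := by
  induction a using WellFoundedLT.induction generalizing x w y v with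
  | ind a ih =>
  obtain ⟨U, hU, hU0, hUc, hUb, hUx⟩ := exists_antitone_isClopen_basis x
  obtain ⟨N, -, -, hNc, hNb, -⟩ := exists_antitone_isClopen_basis y
  have hxU : ∀ n, x ∈ U n := fun n => mem_of_mem_nhds (hUb.mem_of_mem trivial)
  have hyN : ∀ n, y ∈ N n := fun n => mem_of_mem_nhds (hNb.mem_of_mem trivial)
  -- A shell around `x` within `w` misses `Aᵈ[a]`, so it embeds while avoiding a neighbourhood of
  -- `y`. Intersecting that with `N n` makes the successive neighbourhoods a basis at `y`.
  have step : ∀ n, ∀ u : {u : Set Y // IsClopen u ∧ y ∈ u}, ∃ u' : {u : Set Y // IsClopen u ∧ y ∈ u},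
      u'.1 ⊆ u.1 ∩ N n ∧
        EmbedsInto ((A ∩ w) ∩ (U n \ U (n + 1))) (B ∩ (u.1 \ u'.1)) := by
    rintro n ⟨u, hu, hyu⟩
    obtain ⟨u', hu'u, hu', hyu', e⟩ := embedsInto_diff_of_local (B := B) hA ih
      (hw.inter ((hUc n).diff (hUc (n + 1))))
      (eq_empty_of_forall_notMem fun z hz => hz.2.2.2 (by
        rw [h ⟨hz.1, hz.2.1⟩]; exact hxU _)) hy hu hyu
    refine ⟨⟨u' ∩ N n, hu'.inter (hNc n), hyu', hyN n⟩, inter_subset_inter_left _ hu'u,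
      e.mono (by rw [inter_assoc]) ?_⟩
    exact fun z hz => ⟨hz.1, hz.2.1, fun h => hz.2.2 h.1⟩
  choose next hnext hemb using step
  let V : ℕ → {u : Set Y // IsClopen u ∧ y ∈ u} := fun n =>
    Nat.rec ⟨v, hv, hyv⟩ (fun n u => next n u) n
  have hVs : ∀ n, V (n + 1) = next n (V n) := fun n => rfl
  have hVanti : Antitone fun n => (V n).1 := antitone_nat_of_succ_le fun n => by
    rw [hVs]
    exact (hnext n (V n)).trans inter_subset_left
  refine EmbedsInto.of_shells (V := fun n => (V n).1) hU hU0 hUc hUb hUx hVanti ?_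
    ⟨iteratedDerivedSet_subset B a hy, hyv⟩ fun n => ?_
  · refine ⟨fun t => ⟨fun ht => ?_, ?_⟩⟩
    · obtain ⟨n, -, hn⟩ := hNb.mem_iff.mp ht
      exact ⟨n + 1, trivial, ((hnext n (V n)).trans inter_subset_right).trans hn⟩
    · rintro ⟨n, -, hn⟩
      exact mem_of_superset ((V n).2.1.isOpen.mem_nhds (V n).2.2) hn
  · refine (hemb n (V n)).mono subset_rfl fun z hz => ⟨⟨hz.1, ?_⟩, hz.2⟩
    exact hVanti n.zero_le hz.2.1

theorem embedsInto_of_iteratedDerivedSet_inter_eq_empty {A : Set X} {B : Set Y}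
    (hA : IsClosed A) {a : Ordinal} {w : Set X} (hw : IsClopen w) (haw : Aᵈ[a] ∩ w = ∅) {y : Y}
    (hy : y ∈ Bᵈ[a]) : EmbedsInto (A ∩ w) B := by
  obtain ⟨v', -, -, -, e⟩ := embedsInto_diff_of_local (B := B) hA (fun b _ =>
    embedsInto_of_iteratedDerivedSet_inter_subset_singleton hA b) hw haw hy isClopen_univ
    (mem_univ y)
  exact e.mono subset_rfl inter_subset_left

/-- If `A ∩ w` has at most as many points of Cantor–Bendixson rank at least `a` as `B ∩ v`, but at
least one, then `A ∩ w` embeds into `B ∩ v`. -/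
theorem embedsInto_of_encard_iteratedDerivedSet_le {A : Set X} {B : Set Y} (hA : IsClosed A)
    {a : Ordinal} (n : ℕ) {w : Set X} {v : Set Y} (hw : IsClopen w) (hv : IsClopen v)
    (hn : (Aᵈ[a] ∩ w).encard = n + 1) (hB : n + 1 ≤ (Bᵈ[a] ∩ v).encard) :
    EmbedsInto (A ∩ w) (B ∩ v) := by
  induction n generalizing w v with
  | zero =>
    obtain ⟨x, hx⟩ := encard_eq_one.mp (by simpa using hn)
    obtain ⟨y, hy, hyv⟩ := one_le_encard_iff_nonempty.mp (by simpa using hB)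
    have hxw : x ∈ Aᵈ[a] ∩ w := hx.symm ▸ mem_singleton x
    exact embedsInto_of_iteratedDerivedSet_inter_subset_singleton hA a x w hw hxw.2 hx.subset
      y hy v hv hyv
  | succ n ih =>
    have hfin : (Aᵈ[a] ∩ w).Finite := finite_of_encard_eq_coe (k := n + 1 + 1) (by simpa using hn)
    obtain ⟨x, hxa, hxw⟩ : (Aᵈ[a] ∩ w).Nonempty := by
      rw [← one_le_encard_iff_nonempty, hn]
      exact le_add_self
    -- `Bᵈ[a] ∩ v` may be infinite; a finite part `T` of the right size allows `y` to be isolated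
    -- from the other chosen points.
    obtain ⟨T, hTB, hT⟩ := exists_subset_encard_eq hB
    have hTfin : T.Finite := finite_of_encard_eq_coe (k := n + 1 + 1) (by simpa using hT)
    obtain ⟨y, hyT⟩ : T.Nonempty := by
      rw [← one_le_encard_iff_nonempty, hT]
      exact le_add_self
    obtain ⟨c, hc, hxc, hcs⟩ := exists_isClopen_inter_subset_singleton_of_finite hfin x
    obtain ⟨d, hd, hyd, hds⟩ := exists_isClopen_inter_subset_singleton_of_finite hTfin y
    have pred : ((n + 1 : ℕ) + 1 - 1 : ℕ∞) = n + 1 := by norm_cast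
    have e₁ : EmbedsInto (A ∩ (w ∩ c)) (B ∩ (v ∩ d)) :=
      embedsInto_of_iteratedDerivedSet_inter_subset_singleton hA a x _ (hw.inter hc) ⟨hxw, hxc⟩
        (by rwa [← inter_assoc]) y (hTB hyT).1 _ (hv.inter hd) ⟨(hTB hyT).2, hyd⟩
    have e₂ : EmbedsInto (A ∩ (w \ c)) (B ∩ (v \ d)) := by
      refine ih (hw.diff hc) (hv.diff hd) ?_ ?_
      · have : Aᵈ[a] ∩ (w \ c) = (Aᵈ[a] ∩ w) \ {x} := by
          ext z
          refine ⟨fun h => ⟨⟨h.1, h.2.1⟩, fun e => h.2.2 (e ▸ hxc)⟩, fun h => ⟨h.1.1, h.1.2, ?_⟩⟩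
          exact fun hz => h.2 (hcs (mem_inter h.1 hz))
        rw [this, encard_sdiff_singleton_of_mem (mem_inter hxa hxw), hn, pred]
      · have : T \ {y} ⊆ Bᵈ[a] ∩ (v \ d) := fun z hz =>
          ⟨(hTB hz.1).1, (hTB hz.1).2, fun h => hz.2 (hds (mem_inter hz.1 h))⟩
        refine le_trans (le_of_eq ?_) (encard_le_encard this)
        rw [encard_sdiff_singleton_of_mem hyT, hT, pred]
    refine EmbedsInto.of_isClopen_split hc (e₁.mono (by grind) subset_rfl)
      (e₂.mono (by grind) subset_rfl) ?_ (by grind) (by grind)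
    exact disjoint_left.mpr fun z hz hz' => hz'.2.2 hz.2.2

theorem embedsInto_or_embedsInto_of_perfectKernel_eq_empty [Nonempty X] [Nonempty Y] {A : Set X}
    {B : Set Y} (hA : IsClosed A) (hB : IsClosed B)
    (hkA : CantorBendixson.perfectKernel A = ∅) (hkB : CantorBendixson.perfectKernel B = ∅) :
    EmbedsInto A B ∨ EmbedsInto B A := by
  rcases A.eq_empty_or_nonempty with rfl | hAn
  · exact Or.inl (embedsInto_empty _)
  rcases B.eq_empty_or_nonempty with rfl | hBn
  · exact Or.inr (embedsInto_empty _)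
  obtain ⟨a, han, haf, ha⟩ := exists_iteratedDerivedSet_finite_nonempty hA hAn hkA
  obtain ⟨b, hbn, hbf, hb⟩ := exists_iteratedDerivedSet_finite_nonempty hB hBn hkB
  have pred : ∀ {Z : Type u} {s : Set Z}, s.Nonempty → s.Finite → ∃ n : ℕ, s.encard = n + 1 := by
    intro Z s hs hf
    obtain ⟨n, hn⟩ := Nat.exists_eq_succ_of_ne_zero ((ncard_pos hf).mpr hs).ne'
    exact ⟨n, by rw [← hf.cast_ncard_eq, hn]; push_cast; rfl⟩
  rcases lt_trichotomy a b with hab | rfl | hab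
  -- Stage `a + 1` is used: `A` is exhausted there, while `B` still has a point because `a + 1 ≤ b`.
  · obtain ⟨y, hy⟩ := hbn.mono (CantorBendixson.iteratedDerivedSet_antitone B
      (Order.add_one_le_of_lt hab))
    exact Or.inl ((embedsInto_of_iteratedDerivedSet_inter_eq_empty hA isClopen_univ
      (by rw [ha, empty_inter]) hy).mono (by simp) subset_rfl)
  · obtain ⟨m, hm⟩ := pred han haf
    obtain ⟨n, hn⟩ := pred hbn hbf
    rcases le_total m n with hmn | hmn
    · refine Or.inl ((embedsInto_of_encard_iteratedDerivedSet_le (B := B) (a := a) hA m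
        isClopen_univ isClopen_univ (by simpa using hm) ?_).mono (by simp) inter_subset_left)
      rw [inter_univ, hn]
      gcongr
    · refine Or.inr ((embedsInto_of_encard_iteratedDerivedSet_le (B := A) (a := a) hB n
        isClopen_univ isClopen_univ (by simpa using hn) ?_).mono (by simp) inter_subset_left)
      rw [inter_univ, hm]
      gcongr
  · obtain ⟨x, hx⟩ := han.mono (CantorBendixson.iteratedDerivedSet_antitone A
      (Order.add_one_le_of_lt hab))
    exact Or.inr ((embedsInto_of_iteratedDerivedSet_inter_eq_empty hB isClopen_univ
      (by rw [hb, empty_inter]) hx).mono (by simp) subset_rfl)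

end Scattered

/-! ### Embedding through the Cantor space -/

section Cantor

variable {X Y : Type*} [TopologicalSpace X] [TopologicalSpace Y]

/-- There are only countably many clopen sets and they separate points, so their indicator functions
serve as coordinates. -/
theorem exists_continuous_injective_nat_bool [CompactSpace X] [T2Space X]
    [TotallyDisconnectedSpace X] [SecondCountableTopology X] :
    ∃ g : X → ℕ → Bool, Continuous g ∧ Function.Injective g := by
  classical
  have : Countable (TopologicalSpace.Clopens X) :=
    TopologicalSpace.Clopens.countable_iff_secondCountable.mpr inferInstance
  obtain ⟨e, he⟩ := exists_surjective_nat (TopologicalSpace.Clopens X)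
  refine ⟨fun x n => decide (x ∈ e n), continuous_pi fun n => ?_, fun x y h => ?_⟩
  · rw [continuous_bool_rng true]
    convert (e n).isClopen using 1
    ext x
    simp
  · by_contra hxy
    obtain ⟨w, hw, hyw, hxw⟩ := exists_isClopen_mem_notMem hxy
    obtain ⟨n, hn⟩ := he ⟨w, hw⟩
    have h' : x ∈ e n ↔ y ∈ e n := by simpa using congrFun h n
    rw [hn] at h'
    exact hxw (h'.mpr hyw)

theorem Perfect.embedsInto [CompactSpace X] [T2Space X] [TotallyDisconnectedSpace X]
    [SecondCountableTopology X] [PolishSpace Y] {P : Set Y} (hP : Perfect P) (hne : P.Nonempty)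
    (s : Set X) : EmbedsInto s P := by
  let := TopologicalSpace.upgradeIsCompletelyMetrizable Y
  obtain ⟨f, hf, fc, fi⟩ := hP.exists_nat_bool_injection hne
  obtain ⟨g, gc, gi⟩ := exists_continuous_injective_nat_bool (X := X)
  exact ⟨f ∘ g, (fc.comp gc).continuousOn, fun x _ => hf (mem_range_self _), (fi.comp gi).injOn⟩

end Cantor

/-- Any two closed sets in compact zero-dimensional Polish spaces are comparable with respect to
embeddability. -/
theorem embedsInto_or_embedsInto.{u} {X Y : Type u} [TopologicalSpace X] [TopologicalSpace Y]
    [CompactSpace X] [PolishSpace X] [TotallyDisconnectedSpace X] [Nonempty X]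
    [CompactSpace Y] [PolishSpace Y] [TotallyDisconnectedSpace Y] [Nonempty Y]
    {A : Set X} {B : Set Y} (hA : IsClosed A) (hB : IsClosed B) :
    EmbedsInto A B ∨ EmbedsInto B A := by
  rcases (CantorBendixson.perfectKernel B).eq_empty_or_nonempty with hkB | hkB
  · rcases (CantorBendixson.perfectKernel A).eq_empty_or_nonempty with hkA | hkA
    · exact embedsInto_or_embedsInto_of_perfectKernel_eq_empty hA hB hkA hkB
    · exact Or.inr (((CantorBendixson.perfect_perfectKernel hA).embedsInto hkA B).mono subset_rfl
        (CantorBendixson.perfectKernel_subset A))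
  · exact Or.inl (((CantorBendixson.perfect_perfectKernel hB).embedsInto hkB A).mono subset_rfl
      (CantorBendixson.perfectKernel_subset B))

/-! ### AS-sets as closed sets -/

namespace AS

instance HF.instFinite : (n : ℕ) → Finite (HF n)
  | 0 => inferInstanceAs (Finite Unit)
  | n + 1 => by
    have := HF.instFinite n
    exact inferInstanceAs (Finite (Finset (HF n)))

instance HF.instTopologicalSpace (n : ℕ) : TopologicalSpace (HF n) := ⊥

instance HF.instDiscreteTopology (n : ℕ) : DiscreteTopology (HF n) := ⟨rfl⟩

namespace ASet

/-- The topology of approximations. -/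
instance : TopologicalSpace ASet := TopologicalSpace.induced approx inferInstance

theorem approx_injective : Function.Injective approx := fun _ _ h => ASet.ext h

theorem isInducing_approx : IsInducing approx := ⟨rfl⟩

theorem continuous_approx (n : ℕ) : Continuous fun x : ASet => x.approx n :=
  (continuous_apply n).comp isInducing_approx.continuous

theorem continuous_iff_approx {Z : Type*} [TopologicalSpace Z] {f : Z → ASet} :
    Continuous f ↔ ∀ n, Continuous fun z => (f z).approx n := by
  rw [isInducing_approx.continuous_iff, continuous_pi_iff]
  rfl

theorem isClosedEmbedding_approx : IsClosedEmbedding approx := by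
  refine ⟨⟨isInducing_approx, approx_injective⟩, ?_⟩
  have : range approx = ⋂ n, {s : (n : ℕ) → HF n | F n (s (n + 1)) = s n} := by
    ext s
    simp only [mem_range, mem_iInter, mem_ofPred_eq]
    exact ⟨by rintro ⟨x, rfl⟩; exact x.coherent, fun h => ⟨⟨s, h⟩, rfl⟩⟩
  rw [this]
  exact isClosed_iInter fun n => isClosed_eq
    ((continuous_of_discreteTopology (f := F n)).comp (continuous_apply (n + 1)))
    (continuous_apply n)

instance : CompactSpace ASet := isClosedEmbedding_approx.compactSpace

instance : PolishSpace ASet := isClosedEmbedding_approx.polishSpace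

instance : TotallyDisconnectedSpace ASet :=
  ⟨isClosedEmbedding_approx.isEmbedding.isTotallyDisconnected
    (isTotallyDisconnected_of_totallyDisconnectedSpace _)⟩

theorem nhds_hasBasis (x : ASet) :
    (𝓝 x).HasBasis (fun _ => True) fun n => {y : ASet | y.approx n = x.approx n} := by
  refine ⟨fun t => ⟨fun ht => ?_, ?_⟩⟩
  · rw [isInducing_approx.nhds_eq_comap, nhds_pi, mem_comap] at ht
    obtain ⟨u, hu, hut⟩ := ht
    obtain ⟨I, hI, s, hs, hsu⟩ := mem_pi.mp hu
    -- By coherence, agreement at level `N` forces agreement at all levels below, so one level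
    -- controls finitely many coordinates.
    obtain ⟨N, hN⟩ := hI.bddAbove
    refine ⟨N, trivial, fun y hy => hut (hsu fun i hi => ?_)⟩
    rw [approx_eq_of_le (hN hi) hy]
    exact mem_of_mem_nhds (hs i)
  · rintro ⟨n, -, h⟩
    exact mem_of_superset ((isOpen_discrete {x.approx n}).preimage (continuous_approx n)
      |>.mem_nhds rfl) h

theorem isAccPt_iff {x A : ASet} : IsAccPt x A ↔ AccPt x (𝓟 {y | y ∈ A}) := by
  rw [accPt_iff_nhds]
  constructor
  · intro h u hu
    obtain ⟨n, -, hn⟩ := (nhds_hasBasis x).mem_iff.mp hu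
    obtain ⟨y, hyA, hy, hne⟩ := h n
    exact ⟨y, ⟨hn hy, hyA⟩, hne⟩
  · intro h n
    obtain ⟨y, ⟨hy, hyA⟩, hne⟩ := h _ ((nhds_hasBasis x).mem_of_mem (i := n) trivial)
    exact ⟨y, hyA, hy, hne⟩

theorem isClosed_mem (A : ASet) : IsClosed {x | x ∈ A} := by
  have : {x | x ∈ A} = ⋂ n, {x : ASet | x.approx n ∈ HF.elems (A.approx (n + 1))} := by
    ext x
    simp [mem_iff]
  rw [this]
  exact isClosed_iInter fun n => (isClosed_discrete _).preimage (continuous_approx n)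

open Classical in
/-- The approximations of a collection of AS-sets. -/
noncomputable def approxOfSet (C : Set ASet) : (n : ℕ) → HF n
  | 0 => ()
  | n + 1 => (toFinite ((fun x : ASet => x.approx n) '' C)).toFinset

theorem mem_approxOfSet {C : Set ASet} {n : ℕ} {a : HF n} :
    a ∈ HF.elems (approxOfSet C (n + 1)) ↔ ∃ x ∈ C, x.approx n = a := by
  simp [HF.elems, approxOfSet]

/-- The AS-set whose elements are those of the closure of `C`. -/
noncomputable def ofSet (C : Set ASet) : ASet where
  approx := approxOfSet C
  coherent
    | 0 => rfl
    | n + 1 => by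
      refine Finset.ext fun a => ?_
      refine Finset.mem_image.trans (Iff.trans ?_ mem_approxOfSet.symm)
      constructor
      · rintro ⟨b, hb, rfl⟩
        obtain ⟨x, hx, rfl⟩ := mem_approxOfSet.mp hb
        exact ⟨x, hx, (x.coherent n).symm⟩
      · rintro ⟨x, hx, rfl⟩
        exact ⟨x.approx (n + 1), mem_approxOfSet.mpr ⟨x, hx, rfl⟩, x.coherent n⟩

/-- Membership in `ofSet C` says that every basic neighbourhood of `x` meets `C`, that is, that `x`
lies in the closure. -/
theorem mem_ofSet {C : Set ASet} (hC : IsClosed C) {x : ASet} : x ∈ ofSet C ↔ x ∈ C := by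
  refine ⟨fun h => ?_, fun h n => mem_approxOfSet.mpr ⟨x, h, rfl⟩⟩
  rw [← hC.closure_eq, mem_closure_iff_nhds_basis (nhds_hasBasis x)]
  intro n _
  exact mem_approxOfSet.mp (h n)

/-! ### Ordered pairs and graphs -/

theorem continuous_pair : Continuous fun p : ASet × ASet => pair p.1 p.2 := by
  refine continuous_iff_approx.mpr fun n => ?_
  cases n with
  | zero => exact continuous_const
  | succ n =>
    let f : HF n × HF n → HF (n + 1) := fun q => ({q.1, q.2} : Finset (HF n))
    have hf : Continuous f := continuous_of_discreteTopology
    exact hf.comp (((continuous_approx n).comp continuous_fst).prodMk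
      ((continuous_approx n).comp continuous_snd))

theorem continuous_opair : Continuous fun p : ASet × ASet => opair p.1 p.2 :=
  continuous_pair.comp ((continuous_pair.comp (continuous_fst.prodMk continuous_fst)).prodMk
    continuous_pair)

theorem pair_eq_pair {a b c d : ASet} (h : pair a b = pair c d) :
    a = c ∧ b = d ∨ a = d ∧ b = c := by
  have key : ∀ x, (x = a ∨ x = b) ↔ (x = c ∨ x = d) := fun x => by
    rw [← mem_pair, ← mem_pair, h]
  have ha := (key a).mp (Or.inl rfl)
  have hb := (key b).mp (Or.inr rfl)
  have hc := (key c).mpr (Or.inl rfl)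
  have hd := (key d).mpr (Or.inr rfl)
  grind

theorem opair_inj {a b c d : ASet} : opair a b = opair c d ↔ a = c ∧ b = d := by
  refine ⟨fun h => ?_, by rintro ⟨rfl, rfl⟩; rfl⟩
  rcases pair_eq_pair h with ⟨h₁, h₂⟩ | ⟨h₁, h₂⟩ <;> have := pair_eq_pair h₁ <;>
    have := pair_eq_pair h₂ <;> grind

/-- The graph on `A` of a function on the universe. -/
noncomputable def graph (g : ASet → ASet) (A : ASet) : ASet :=
  ofSet ((fun a => opair a (g a)) '' {a | a ∈ A})

/-- The pairs form a continuous image of a compact set, hence a closed set, so `ofSet` adds no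
further elements. -/
theorem opair_mem_graph {g : ASet → ASet} {A : ASet} (hg : ContinuousOn g {a | a ∈ A})
    {p : ASet} : p ∈ graph g A ↔ ∃ a ∈ A, opair a (g a) = p := by
  have hc : ContinuousOn (fun a => opair a (g a)) {a | a ∈ A} :=
    Continuous.comp_continuousOn (g := fun p : ASet × ASet => opair p.1 p.2)
      (f := fun a => (a, g a)) continuous_opair (continuousOn_id.prodMk hg)
  exact mem_ofSet ((isClosed_mem A).isCompact.image_of_continuousOn hc).isClosed

theorem exists_isBijection_of_embedsInto {A B : ASet}
    (h : EmbedsInto {a | a ∈ A} {b | b ∈ B}) :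
    ∃ B' : ASet, B' ⊆ B ∧ ∃ f : ASet, f.IsBijection A B' ∧ f.IsInjection A B := by
  obtain ⟨g, gc, gm, gi⟩ := h
  have hB' : ∀ {b}, b ∈ ofSet (g '' {a | a ∈ A}) ↔ ∃ a ∈ A, g a = b :=
    mem_ofSet ((isClosed_mem A).isCompact.image_of_continuousOn gc).isClosed
  have hf : ∀ {a b}, opair a b ∈ graph g A ↔ a ∈ A ∧ g a = b := by
    intro a b
    rw [opair_mem_graph gc]
    simp only [opair_inj]
    exact ⟨by rintro ⟨_, h, rfl, rfl⟩; exact ⟨h, rfl⟩, fun ⟨h, e⟩ => ⟨a, h, rfl, e⟩⟩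
  have inj : ∀ C : ASet, (∀ a ∈ A, g a ∈ C) → (graph g A).IsInjection A C := by
    refine fun C hC => ⟨⟨fun p hp => ?_, fun a ha => ⟨g a, hC a ha, hf.mpr ⟨ha, rfl⟩⟩, ?_⟩, ?_⟩
    · obtain ⟨a, ha, rfl⟩ := (opair_mem_graph gc).mp hp
      exact ⟨a, ha, g a, hC a ha, rfl⟩
    · intro a b b' h h'
      rw [← (hf.mp h).2, (hf.mp h').2]
    · intro a a' b h h'
      exact gi (hf.mp h).1 (hf.mp h').1 ((hf.mp h).2.trans (hf.mp h').2.symm)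
  refine ⟨ofSet (g '' {a | a ∈ A}), fun b hb => ?_, graph g A, ⟨inj _ fun a ha => ?_, ?_⟩,
    inj B gm⟩
  · obtain ⟨a, ha, rfl⟩ := hB'.mp hb
    exact gm ha
  · exact hB'.mpr ⟨a, ha, rfl⟩
  · intro b hb
    obtain ⟨a, ha, e⟩ := hB'.mp hb
    exact ⟨a, ha, hf.mpr ⟨ha, e⟩⟩

theorem cardLE_of_embedsInto {A B : ASet} (h : EmbedsInto {a | a ∈ A} {b | b ∈ B}) :
    A.CardLE B := by
  obtain ⟨-, -, f, -, hf⟩ := exists_isBijection_of_embedsInto h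
  exact ⟨f, hf⟩

theorem cardLE_total (A B : ASet) : A.CardLE B ∨ B.CardLE A := by
  have : Nonempty ASet := ⟨A⟩
  exact (embedsInto_or_embedsInto (isClosed_mem A) (isClosed_mem B)).imp cardLE_of_embedsInto
    cardLE_of_embedsInto

theorem IsPerfect.embedsInto {P : ASet} (hP : P.IsPerfect) (A : ASet) :
    EmbedsInto {a | a ∈ A} {b | b ∈ P} :=
  Perfect.embedsInto ⟨isClosed_mem P, fun x hx => isAccPt_iff.mp (hP.2.2 x hx)⟩ hP.1 _

end ASet

end AS

theorem theorem7p15 :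
    (∀ A B : AS.ASet,
      (A.CardLE B ∨ B.CardLE A) ∧
      ((A.CardLT B ∧ ¬ A.CardEq B ∧ ¬ B.CardLT A) ∨
        (¬ A.CardLT B ∧ A.CardEq B ∧ ¬ B.CardLT A) ∨
        (¬ A.CardLT B ∧ ¬ A.CardEq B ∧ B.CardLT A))) ∧
    (∀ P : AS.ASet, P.IsPerfect →
      ∀ A : AS.ASet, ∃ P' : AS.ASet, P' ⊆ P ∧ ∃ f : AS.ASet, f.IsBijection A P') ∧
    (∀ B : AS.ASet, (∃ P : AS.ASet, P ⊆ B ∧ P.IsPerfect) →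
      ∀ A : AS.ASet, A.CardLE B) := by
  refine ⟨fun A B => ?_, fun P hP A => ?_, fun B ⟨P, hPB, hP⟩ A => ?_⟩
  · have h := AS.ASet.cardLE_total A B
    refine ⟨h, ?_⟩
    unfold AS.ASet.CardLT AS.ASet.CardEq
    tauto
  · obtain ⟨P', hP', f, hf, -⟩ := AS.ASet.exists_isBijection_of_embedsInto (hP.embedsInto A)
    exact ⟨P', hP', f, hf⟩
  · exact AS.ASet.cardLE_of_embedsInto ((hP.embedsInto A).mono subset_rfl hPB)
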